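/- Let $F$ be a field, let $n\ge 3$, and let $I_n\subset R_n=F[x_1,\dots,x_n]$ be the ideal generated by the binomials $\prod_{k\ne i}x_k-x_i$ for $i=1,\dots,n$. Put $A_n=R_n/I_n$. For $b\ge 0$ and $T\subseteq\{2,\dots,n-1\}$ let $m(b,T)$ denote the class of $x_n^{b}\prod_{i\in T}x_i$ in $A_n$. Then the elements $m(b,T)$ with $0\le b<2n-4$ and $T\subseteq\{2,\dots,n-1\}$, together with $m(2n-4,\emptyset)=x_n^{2n-4}$, form an $F$-basis $\mathcal B$ of $A_n$, and the set of basis elements $\mathcal B'=\mathcal B\setminus\{1\}$ has $(n-2)2^{n-1}$ elements. For $1\le j\le n$ let $T_j$ be the matrix of multiplication by $x_j$ on $A_n$ with respect to $\mathcal B$ (that is, $x_j m_r=\sum_\ell (T_j)_{r\ell}\,m_\ell$), and let $P_j$ be the matrix obtained from $T_j$ by deleting the row and the column of the basis element $1$. Then, for every $j=1,\dots,n$, the matrix $P_j$ is the permutation matrix of a permutation $\sigma_j$ of (the index set of) $\mathcal B'$, that is, $(P_j)_{r\ell}=1$ if $\ell=\sigma_j(r)$ and $(P_j)_{r\ell}=0$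 otherwise. The permutation $\sigma_j$ has no fixed points and is the product of exactly $2^{n-2}$ disjoint cycles, each of length $2(n-2)$. Moreover, $P_j$ has multiplicative order and characteristic polynomial $$\operatorname{Ord}(P_j)=2(n-2),\qquad \chi_{P_j}(t)=\left(t^{2(n-2)}-1\right)^{2^{n-2}}.$$ -/

import Mathlib

/-- The ideal `I_n` of `F[x_1, …, x_n]` generated by the binomials
`x_1 ⋯ x_{i-1} x_{i+1} ⋯ x_n - x_i`; the variable `x_i` is `X (i - 1)`, with `i - 1 : Fin n`. -/
noncomputable def binomIdeal (F : Type*) [Field F] (n : ℕ) : Ideal (MvPolynomial (Fin n) F) :=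
  Ideal.span (Set.range fun i : Fin n =>
    (∏ k ∈ Finset.univ.erase i, MvPolynomial.X k) - MvPolynomial.X i)

/-- The quotient algebra `A_n = F[x_1, …, x_n] / I_n`. -/
abbrev QuotAlg (F : Type*) [Field F] (n : ℕ) : Type _ :=
  MvPolynomial (Fin n) F ⧸ binomIdeal F n

/-- The class of the `j`-th variable in `A_n`. -/
noncomputable def xbar (F : Type*) [Field F] {n : ℕ} (j : Fin n) : QuotAlg F n :=
  Ideal.Quotient.mk (binomIdeal F n) (MvPolynomial.X j)

/-- The index of the last variable `x_n`. -/
def lastVar {n : ℕ} (hn : 3 ≤ n) : Fin n := ⟨n - 1, by omega⟩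

/-- The indices of the middle variables `x_2, …, x_{n-1}`. -/
def midVars (n : ℕ) : Finset (Fin n) :=
  Finset.univ.filter fun i => 0 < i.val ∧ i.val + 1 < n

/-- The pairs `(b, T)` that label the monomial basis: `T ⊆ {2, …, n-1}` and `0 ≤ b < 2n - 4`,
together with the extra pair `(2n - 4, ∅)`. -/
def basisIndex (n : ℕ) : Finset (ℕ × Finset (Fin n)) :=
  (Finset.range (2 * n - 4) ×ˢ (midVars n).powerset) ∪ {(2 * n - 4, ∅)}

/-- The labels of the basis monomials other than `1 = m(0, ∅)`. -/
def reducedIndex (n : ℕ) : Finset (ℕ × Finset (Fin n)) :=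
  (basisIndex n).erase (0, ∅)

/-- The inclusion of the labels of the nonconstant basis monomials among all labels. -/
def reducedIncl (n : ℕ) (r : reducedIndex n) : basisIndex n :=
  ⟨r.1, Finset.mem_of_mem_erase r.2⟩

/-- The class in `A_n` of the monomial `m(b, T) = x_n^b ∏_{i ∈ T} x_i`. -/
noncomputable def stdMonomial (F : Type*) [Field F] {n : ℕ} (hn : 3 ≤ n) (p : ℕ × Finset (Fin n)) :
    QuotAlg F n :=
  xbar F (lastVar hn) ^ p.1 * ∏ i ∈ p.2, xbar F i

/-- The companion matrix `T_j` of multiplication by `x_j` in a basis `(m_r)` of `A_n`, in the row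
convention `x_j * m_r = ∑ l, (T_j) r l • m_l`. -/
noncomputable def companionMatrix {F : Type*} [Field F] {n : ℕ}
    (B : Module.Basis (basisIndex n) F (QuotAlg F n)) (j : Fin n) :
    Matrix (basisIndex n) (basisIndex n) F :=
  Matrix.of fun r l => B.repr (LinearMap.mulLeft F (xbar F j) (B r)) l

/-- The reduced companion matrix `P_j`: the row and the column of the basis element `1` are
deleted from `T_j`. -/
noncomputable def reducedCompanion {F : Type*} [Field F] {n : ℕ}
    (B : Module.Basis (basisIndex n) F (QuotAlg F n)) (j : Fin n) :
    Matrix (reducedIndex n) (reducedIndex n) F :=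
  (companionMatrix B j).submatrix (reducedIncl n) (reducedIncl n)

/-! In `A_n` every `x_i ^ 2` equals the product of all variables, and `x_n ^ (2n-4)` fixes each
`x_i` (`xbar_last_pow_mul_xbar`). Hence every product of a variable with a basis monomial reduces to
a nonconstant basis monomial, and the basis monomials span.

For independence, `A_n` is mapped to `F × F[G]` with `x_i ↦ (0, varExp i)`: the first factor detects
`1`, and the second sends the other basis monomials to distinct elements of `G`
(`monomialExp_injOn`).

In `G`, multiplication by `x_j` is translation by `varExp j`, of order `2(n-2)`
(`nsmul_varExp_eq_zero_iff`). So `x_j` permutes the nonconstant monomials with all orbits of that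
length. Number of cycles, order and characteristic polynomial then follow from the orbit length and
the cardinality alone. -/

namespace Equiv.Perm

/-! ### Permutations whose orbits all have the same length. -/

variable {ι : Type*} {σ : Equiv.Perm ι} {d : ℕ}

/-- A permutation all of whose orbits have length `d` has order `d`. -/
theorem orderOf_eq_of_pow_apply_eq_iff [Nonempty ι]
    (hσ : ∀ x (k : ℕ), (σ ^ k) x = x ↔ d ∣ k) : orderOf σ = d := by
  refine Nat.dvd_antisymm ?_ ?_
  · rw [orderOf_dvd_iff_pow_eq_one]
    ext x
    exact (hσ x d).2 dvd_rfl
  · obtain ⟨x⟩ := ‹Nonempty ι›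
    exact (hσ x _).1 (by simp [pow_orderOf_eq_one])

/-- A permutation all of whose orbits have length `d` is a disjoint union of rotations. -/
theorem exists_equiv_prod_fin [Finite ι] (hd : 0 < d) (hσ : ∀ x (k : ℕ), (σ ^ k) x = x ↔ d ∣ k) :
    ∃ e : Quotient (SameCycle.setoid σ) × Fin d ≃ ι,
      ∀ q i, σ (e (q, i)) = e (q, finRotate d i) := by
  have hdone : σ ^ d = 1 := by
    ext x
    exact (hσ x d).2 dvd_rfl
  have hmod : ∀ k : ℕ, σ ^ (k % d) = σ ^ k := fun k => (pow_eq_pow_mod k hdone).symm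
  let f : Quotient (SameCycle.setoid σ) × Fin d → ι := fun p => (σ ^ (p.2 : ℕ)) p.1.out
  have hfq : ∀ p, (Quotient.mk (SameCycle.setoid σ) (f p)) = p.1 := by
    intro p
    conv_rhs => rw [← Quotient.out_eq p.1]
    refine Quotient.sound ?_
    exact (sameCycle_pow_left).2 (SameCycle.refl _ _)
  have hinj : Function.Injective f := by
    rintro ⟨q, i⟩ ⟨q', j⟩ h
    have hq : q = q' := (hfq (q, i)).symm.trans ((congrArg _ h).trans (hfq (q', j)))
    subst hq
    simp only [f] at h
    wlog hij : i ≤ j generalizing i j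
    · exact (this j i h.symm (le_of_not_ge hij)).symm
    have hle : (i : ℕ) ≤ j := hij
    have : (σ ^ ((j : ℕ) - i)) q.out = q.out := by
      apply (σ ^ (i : ℕ)).injective
      rw [← Equiv.Perm.mul_apply, ← pow_add, Nat.add_sub_cancel' hle, h]
    have hdvd := (hσ _ _).1 this
    have := Nat.eq_zero_of_dvd_of_lt hdvd (by have := j.2; omega)
    have : i = j := Fin.ext (by omega)
    rw [this]
  have hsurj : Function.Surjective f := by
    intro x
    have hx : SameCycle σ (Quotient.mk (SameCycle.setoid σ) x).out x :=
      Quotient.exact (Quotient.out_eq (Quotient.mk (SameCycle.setoid σ) x))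
    obtain ⟨k, -, hk⟩ := hx.exists_pow_eq'
    refine ⟨(Quotient.mk (SameCycle.setoid σ) x, ⟨k % d, Nat.mod_lt _ hd⟩), ?_⟩
    simp only [f, hmod, hk]
  refine ⟨Equiv.ofBijective f ⟨hinj, hsurj⟩, fun q i => ?_⟩
  change σ ((σ ^ (i : ℕ)) q.out) = (σ ^ (finRotate d i : ℕ)) q.out
  rw [← Equiv.Perm.mul_apply, ← pow_succ']
  obtain ⟨m, rfl⟩ : ∃ m, d = m + 1 := ⟨d - 1, by omega⟩
  rw [coe_finRotate]
  split_ifs with hi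
  · rw [hi, Fin.val_last, hdone, pow_zero]
  · rfl

variable [Fintype ι] [DecidableEq ι]

theorem orderOf_permMatrix (F : Type*) [Semiring F] [Nontrivial F] (σ : Equiv.Perm ι) :
    orderOf (σ.permMatrix F) = orderOf σ := by
  have hinj : Function.Injective (Matrix.permMatrixHom (n := ι) (R := F)) := by
    intro s t h
    ext x
    have h1 := congrFun (congrFun h (s x)) x
    by_contra hne
    have hne' : ¬ t.symm (s x) = x := fun h => hne (t.symm_apply_eq.1 h)
    rw [Matrix.permMatrixHom_apply, Matrix.permMatrixHom_apply, Equiv.Perm.permMatrix,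
      Equiv.Perm.permMatrix, PEquiv.toMatrix_toPEquiv_apply, PEquiv.toMatrix_toPEquiv_apply] at h1
    simp [eq_comm (a := x), hne'] at h1
  -- `permMatrixHom` inverts its argument to become multiplicative, hence `σ⁻¹`.
  have := orderOf_injective _ hinj σ⁻¹
  simpa using this

theorem support_eq_univ_of_pow_apply_eq_iff (hd : 2 ≤ d)
    (hσ : ∀ x (k : ℕ), (σ ^ k) x = x ↔ d ∣ k) : σ.support = Finset.univ := by
  ext x
  have := hσ x 1
  simp only [pow_one, Nat.dvd_one] at this
  simp only [mem_support, Finset.mem_univ, iff_true, ne_eq, this]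
  omega

/-- A cycle factor `c` is `cycleOf σ a` for any `a` it moves, so `c ^ k` is trivial exactly when `σ
^ k` fixes `a`. -/
theorem card_support_of_mem_cycleFactorsFinset
    (hσ : ∀ x (k : ℕ), (σ ^ k) x = x ↔ d ∣ k) {c : Equiv.Perm ι}
    (hc : c ∈ σ.cycleFactorsFinset) : c.support.card = d := by
  have hcyc := (mem_cycleFactorsFinset_iff.1 hc).1
  obtain ⟨a, ha⟩ := hcyc.nonempty_support
  have hca := cycle_is_cycleOf ha hc
  rw [← hcyc.orderOf]
  have key : ∀ k : ℕ, c ^ k = 1 ↔ d ∣ k := by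
    intro k
    rw [hcyc.pow_eq_one_iff' (mem_support.1 ha), ← hσ a k, hca, cycleOf_pow_apply_self]
  refine Nat.dvd_antisymm ?_ ?_
  · rw [orderOf_dvd_iff_pow_eq_one, key]
  · rw [← key, pow_orderOf_eq_one]

theorem card_cycleFactorsFinset_mul (hd : 2 ≤ d)
    (hσ : ∀ x (k : ℕ), (σ ^ k) x = x ↔ d ∣ k) :
    σ.cycleFactorsFinset.card * d = Fintype.card ι := by
  have h := σ.sum_cycleType
  rw [support_eq_univ_of_pow_apply_eq_iff hd hσ, cycleType_def, Finset.card_univ] at h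
  rw [← h]
  change _ = ∑ c ∈ σ.cycleFactorsFinset, c.support.card
  rw [Finset.sum_congr rfl fun c hc => card_support_of_mem_cycleFactorsFinset hσ hc]
  simp

/-- Up to transposition, the rotation is the matrix of multiplication by the root in `F[X]/(X^d -
1)`, in the power basis; its characteristic polynomial is the minimal polynomial of the root. -/
theorem charpoly_permMatrix_finRotate (F : Type*) [Field F] (hd : 0 < d) :
    ((finRotate d).permMatrix F).charpoly = (Polynomial.X : Polynomial F) ^ d - 1 := by
  set f : Polynomial F := Polynomial.X ^ d - 1 with hf
  have hmon : f.Monic := Polynomial.monic_X_pow_sub_C 1 hd.ne'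
  have hdeg : f.natDegree = d := Polynomial.natDegree_X_pow_sub_C
  set h := AdjoinRoot.powerBasis hmon.ne_zero with hh
  have hdim : h.dim = d := by rw [hh, AdjoinRoot.powerBasis_dim, hdeg]
  have hgen : h.gen = AdjoinRoot.root f := AdjoinRoot.powerBasis_gen _
  have hpow : h.gen ^ d = 1 := by
    have := AdjoinRoot.eval₂_root f
    rw [hf] at this
    simp only [Polynomial.eval₂_sub, Polynomial.eval₂_pow, Polynomial.eval₂_X,
      Polynomial.eval₂_one] at this
    rw [hgen]
    exact sub_eq_zero.1 this
  have hmin := charpoly_leftMulMatrix h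
  rw [hgen, AdjoinRoot.minpoly_root hmon.ne_zero, hmon.leadingCoeff, inv_one, map_one, mul_one,
    ← hgen] at hmin
  rw [← hmin, ← Matrix.charpoly_transpose, ← Matrix.charpoly_reindex (finCongr hdim)]
  congr 1
  ext i j
  obtain ⟨m, rfl⟩ : ∃ m, d = m + 1 := ⟨d - 1, by omega⟩
  have hmul : h.gen * h.basis ((finCongr hdim).symm j)
      = h.basis ((finCongr hdim).symm (finRotate (m + 1) j)) := by
    simp only [PowerBasis.coe_basis, ← pow_succ', finCongr_symm, finCongr_apply, Fin.val_cast]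
    rw [coe_finRotate]
    split_ifs with hj
    · simp [hj, hpow]
    · rfl
  rw [Matrix.transpose_apply, Matrix.reindex_apply, Matrix.submatrix_apply,
    Algebra.leftMulMatrix_eq_repr_mul, hmul, Module.Basis.repr_self]
  simp [Equiv.Perm.permMatrix, Finsupp.single_apply, eq_comm]

theorem charpoly_permMatrix_of_pow_apply_eq_iff (F : Type*) [Field F] (hd : 0 < d) {m : ℕ}
    (hm : m * d = Fintype.card ι) (hσ : ∀ x (k : ℕ), (σ ^ k) x = x ↔ d ∣ k) :
    (σ.permMatrix F).charpoly = ((Polynomial.X : Polynomial F) ^ d - 1) ^ m := by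
  classical
  obtain ⟨e, he⟩ := exists_equiv_prod_fin hd hσ
  have : Fintype (Quotient (SameCycle.setoid σ)) := Fintype.ofFinite _
  have hcard : Fintype.card (Quotient (SameCycle.setoid σ)) = m := by
    have := Fintype.card_congr e
    rw [Fintype.card_prod, Fintype.card_fin, ← hm] at this
    exact Nat.eq_of_mul_eq_mul_right hd this
  -- One rotation block per orbit; the swap is there because `blockDiagonal` takes the block index
  -- second.
  have hblock : Matrix.reindex ((Equiv.prodComm _ _).trans e).symm
      ((Equiv.prodComm _ _).trans e).symm (σ.permMatrix F).charmatrix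
      = Matrix.blockDiagonal fun _ : Quotient (SameCycle.setoid σ) =>
          ((finRotate d).permMatrix F).charmatrix := by
    ext ⟨i, q⟩ ⟨j, q'⟩ : 1
    have hinj : ∀ q i q' j, e (q, i) = e (q', j) ↔ q = q' ∧ i = j := fun q i q' j => by
      rw [e.injective.eq_iff, Prod.mk.injEq]
    rw [Matrix.blockDiagonal_apply, Matrix.reindex_apply, Matrix.submatrix_apply,
      Matrix.charmatrix_apply, Matrix.charmatrix_apply, Equiv.Perm.permMatrix,
      Equiv.Perm.permMatrix, PEquiv.toMatrix_toPEquiv_apply, PEquiv.toMatrix_toPEquiv_apply]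
    by_cases hq : q = q'
    · subst hq
      simp [he, Matrix.diagonal_apply, Pi.single_apply, hinj]
    · simp [he, hinj, hq, Ne.symm hq]
  rw [Matrix.charpoly, ← Matrix.det_reindex_self ((Equiv.prodComm _ _).trans e).symm, hblock,
    Matrix.det_blockDiagonal]
  simp only [Finset.prod_const, Finset.card_univ, hcard]
  rw [← charpoly_permMatrix_finRotate F hd, Matrix.charpoly]

end Equiv.Perm

/-! ### Labels of the basis monomials. -/

theorem mem_midVars {n : ℕ} {i : Fin n} : i ∈ midVars n ↔ 0 < i.val ∧ i.val + 1 < n := by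
  simp [midVars]

theorem card_midVars {n : ℕ} (hn : 3 ≤ n) : (midVars n).card = n - 2 := by
  have : midVars n = (Finset.univ.erase ⟨0, by omega⟩).erase (lastVar hn) := by
    ext i
    simp only [mem_midVars, lastVar, Finset.mem_erase, Finset.mem_univ, ne_eq, Fin.ext_iff,
      and_true]
    omega
  rw [this, Finset.card_erase_of_mem, Finset.card_erase_of_mem (Finset.mem_univ _),
    Finset.card_univ, Fintype.card_fin, Nat.sub_sub]
  simp only [Finset.mem_erase, Finset.mem_univ, lastVar, ne_eq, Fin.ext_iff, and_true]
  omega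

theorem mem_basisIndex {n : ℕ} {p : ℕ × Finset (Fin n)} :
    p ∈ basisIndex n ↔ (p.1 < 2 * n - 4 ∧ p.2 ⊆ midVars n) ∨ p = (2 * n - 4, ∅) := by
  simp [basisIndex, or_comm]

theorem mem_reducedIndex {n : ℕ} {p : ℕ × Finset (Fin n)} :
    p ∈ reducedIndex n ↔ p ≠ (0, ∅) ∧ p ∈ basisIndex n := by
  simp [reducedIndex]

theorem subset_midVars_of_mem_basisIndex {n : ℕ} {p : ℕ × Finset (Fin n)}
    (hp : p ∈ basisIndex n) : p.2 ⊆ midVars n := by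
  rcases mem_basisIndex.1 hp with h | rfl
  · exact h.2
  · exact Finset.empty_subset _

theorem zero_mem_basisIndex {n : ℕ} (hn : 3 ≤ n) :
    ((0, ∅) : ℕ × Finset (Fin n)) ∈ basisIndex n :=
  mem_basisIndex.2 (Or.inl ⟨by simp only; omega, Finset.empty_subset _⟩)

theorem top_mem_reducedIndex {n : ℕ} (hn : 3 ≤ n) :
    ((2 * n - 4, ∅) : ℕ × Finset (Fin n)) ∈ reducedIndex n := by
  refine mem_reducedIndex.2 ⟨fun h => ?_, mem_basisIndex.2 (Or.inr rfl)⟩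
  have := congrArg Prod.fst h
  simp only at this
  omega

theorem card_reducedIndex {n : ℕ} (hn : 3 ≤ n) :
    (reducedIndex n).card = (n - 2) * 2 ^ (n - 1) := by
  rw [reducedIndex, Finset.card_erase_of_mem (zero_mem_basisIndex hn), basisIndex,
    Finset.card_union_of_disjoint (by simp), Finset.card_product, Finset.card_powerset,
    card_midVars hn, Finset.card_range, Finset.card_singleton, Nat.add_sub_cancel]
  obtain ⟨m, rfl⟩ : ∃ m, n = m + 3 := ⟨n - 3, by omega⟩
  have h1 : 2 * (m + 3) - 4 = 2 * (m + 1) := by omega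
  have h2 : m + 3 - 2 = m + 1 := by omega
  have h3 : m + 3 - 1 = m + 1 + 1 := by omega
  rw [h1, h2, h3, pow_succ 2 (m + 1)]
  ring

/-! ### Exponent group -/

/-- The group in which the nonconstant monomials of `A_n` are realized. -/
abbrev ExpGroup (n : ℕ) : Type := ZMod (2 * n - 4) × (Fin n → ZMod 2)

/-- The exponent of the variable with index `i`. -/
def varExp {n : ℕ} (i : Fin n) : ExpGroup n :=
  (if i.val = 0 then (n - 1 : ℕ) else 1,
    fun k => if k ∈ midVars n ∧ (i.val = 0 ∨ i = k) then 1 else 0)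

theorem natCast_two_mul_sub_two {n : ℕ} (hn : 3 ≤ n) :
    ((2 * (n - 1) : ℕ) : ZMod (2 * n - 4)) = 2 := by
  have : 2 * (n - 1) = (2 * n - 4) + 2 := by omega
  rw [this, Nat.cast_add, ZMod.natCast_self, zero_add, Nat.cast_ofNat]

theorem varExp_add_self {n : ℕ} (hn : 3 ≤ n) (i : Fin n) :
    varExp i + varExp i = ((2, 0) : ExpGroup n) := by
  refine Prod.ext ?_ (funext fun k => ?_)
  · simp only [varExp, Prod.fst_add]
    split_ifs
    · rw [← natCast_two_mul_sub_two hn]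
      push_cast
      ring
    · norm_num
  · exact CharTwo.add_self_eq_zero _

/-- Each middle coordinate `k` is hit exactly twice, by `x_1` and by the variable `k`, and cancels
mod 2. -/
theorem sum_varExp {n : ℕ} (hn : 3 ≤ n) : ∑ i, varExp i = ((2, 0) : ExpGroup n) := by
  refine Prod.ext ?_ (funext fun k => ?_)
  · rw [Prod.fst_sum]
    obtain ⟨m, rfl⟩ : ∃ m, n = m + 1 := ⟨n - 1, by omega⟩
    rw [Fin.sum_univ_succ, ← natCast_two_mul_sub_two hn]
    simp [varExp]
    ring
  · rw [Prod.snd_sum, Finset.sum_apply]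
    by_cases hk : k ∈ midVars n
    · have h0 : (⟨0, by omega⟩ : Fin n) ≠ k := fun h => by
        have := (mem_midVars.1 hk).1
        rw [← h] at this
        exact lt_irrefl _ this
      have hsub : ({⟨0, by omega⟩, k} : Finset (Fin n)) ⊆ Finset.univ := Finset.subset_univ _
      rw [← Finset.sum_subset hsub, Finset.sum_pair h0]
      · simp only [varExp, hk, true_and, true_or, or_true, if_true]
        exact CharTwo.add_self_eq_zero _
      · intro i _ hi
        simp only [Finset.mem_insert, Finset.mem_singleton, not_or, Fin.ext_iff] at hi
        simp [varExp, Fin.ext_iff, hi.1, hi.2]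
    · simp [varExp, hk]

theorem sum_erase_varExp {n : ℕ} (hn : 3 ≤ n) (i : Fin n) :
    ∑ k ∈ Finset.univ.erase i, varExp k = varExp i := by
  apply add_left_cancel (a := varExp i)
  rw [Finset.add_sum_erase _ _ (Finset.mem_univ i), sum_varExp hn, varExp_add_self hn]

/-- For `j ≠ 0` the first coordinate decides. For `j = 0` a middle coordinate forces `k = 2l`; then
`n - 2 ∣ (n - 1) l`, and `n - 1` is coprime to `n - 2`. -/
theorem nsmul_varExp_eq_zero_iff {n : ℕ} (hn : 3 ≤ n) (j : Fin n) (k : ℕ) :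
    k • varExp j = 0 ↔ 2 * (n - 2) ∣ k := by
  have hN : 2 * (n - 2) = 2 * n - 4 := by omega
  constructor
  · intro h
    have h1 := congrArg Prod.fst h
    rw [Prod.smul_fst, nsmul_eq_mul, Prod.fst_zero] at h1
    simp only [varExp] at h1
    split_ifs at h1 with hj
    · have h2 := congrFun (congrArg Prod.snd h) ⟨1, by omega⟩
      have hm : (⟨1, by omega⟩ : Fin n) ∈ midVars n := mem_midVars.2 ⟨one_pos, by simp only; omega⟩
      rw [Prod.smul_snd, Pi.smul_apply, nsmul_eq_mul] at h2
      simp only [varExp, hm, hj, true_and, true_or, if_true, mul_one, Prod.snd_zero,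
        Pi.zero_apply] at h2
      rw [ZMod.natCast_eq_zero_iff] at h2
      obtain ⟨l, rfl⟩ := h2
      rw [← Nat.cast_mul, ZMod.natCast_eq_zero_iff, ← hN, mul_assoc] at h1
      have h3 := Nat.dvd_of_mul_dvd_mul_left two_pos h1
      refine mul_dvd_mul_left 2 (Nat.Coprime.dvd_of_dvd_mul_right ?_ h3)
      have : n - 1 = n - 2 + 1 := by omega
      rw [this]
      exact Nat.coprime_self_add_right.2 (Nat.coprime_one_right _)
    · rw [mul_one, ZMod.natCast_eq_zero_iff] at h1
      rwa [hN]
  · rintro ⟨l, rfl⟩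
    refine Prod.ext ?_ (funext fun i => ?_)
    · rw [Prod.smul_fst, nsmul_eq_mul, hN, Nat.cast_mul, ZMod.natCast_self]
      simp
    · rw [Prod.smul_snd, Pi.smul_apply, nsmul_eq_mul, Nat.cast_mul, Nat.cast_mul]
      rw [ZMod.natCast_self]
      simp

/-- The exponent of the monomial `m(b, T)`. -/
def monomialExp {n : ℕ} (hn : 3 ≤ n) (p : ℕ × Finset (Fin n)) : ExpGroup n :=
  p.1 • varExp (lastVar hn) + ∑ i ∈ p.2, varExp i

theorem monomialExp_fst {n : ℕ} (hn : 3 ≤ n) {p : ℕ × Finset (Fin n)} (hp : p.2 ⊆ midVars n) :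
    (monomialExp hn p).1 = ((p.1 + p.2.card : ℕ) : ZMod (2 * n - 4)) := by
  have hl : (lastVar hn).val ≠ 0 := by simp only [lastVar]; omega
  have hs : ∑ i ∈ p.2, (varExp i).1 = (p.2.card : ZMod (2 * n - 4)) := by
    rw [Finset.card_eq_sum_ones, Nat.cast_sum]
    refine Finset.sum_congr rfl fun i hi => ?_
    simp [varExp, (mem_midVars.1 (hp hi)).1.ne']
  rw [monomialExp, Prod.fst_add, Prod.smul_fst, Prod.fst_sum, hs]
  simp [varExp, hl]

theorem monomialExp_snd {n : ℕ} (hn : 3 ≤ n) {p : ℕ × Finset (Fin n)} (hp : p.2 ⊆ midVars n)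
    (k : Fin n) : (monomialExp hn p).2 k = if k ∈ p.2 then 1 else 0 := by
  have hl : (varExp (lastVar hn)).2 k = 0 := by
    have hl' : (lastVar hn).val ≠ 0 := by simp only [lastVar]; omega
    simp only [varExp, hl', false_or, ite_eq_right_iff, one_ne_zero, imp_false, not_and]
    rintro hk rfl
    have := (mem_midVars.1 hk).2
    simp only [lastVar] at this
    omega
  rw [monomialExp, Prod.snd_add, Pi.add_apply, Prod.smul_snd, Pi.smul_apply, hl, smul_zero,
    zero_add, Prod.snd_sum, Finset.sum_apply]
  rw [Finset.sum_congr rfl (g := fun i => if i = k then (1 : ZMod 2) else 0), Finset.sum_ite_eq']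
  intro i hi
  have hi' := hp hi
  have h0 := (mem_midVars.1 hi').1.ne'
  simp only [varExp, h0, false_or]
  by_cases hik : i = k
  · subst hik
    simp [hi']
  · simp [hik]

/-- The second coordinate recovers `T`, the first then `b` mod `2n - 4`. The only collision among
all labels is `(0, ∅)` with `(2n - 4, ∅)`, removed by discarding `1`. -/
theorem monomialExp_injOn {n : ℕ} (hn : 3 ≤ n) {p q : ℕ × Finset (Fin n)}
    (hp : p ∈ reducedIndex n) (hq : q ∈ reducedIndex n)
    (h : monomialExp hn p = monomialExp hn q) : p = q := by
  obtain ⟨hp0, hp⟩ := mem_reducedIndex.1 hp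
  obtain ⟨hq0, hq⟩ := mem_reducedIndex.1 hq
  have hpm := subset_midVars_of_mem_basisIndex hp
  have hqm := subset_midVars_of_mem_basisIndex hq
  have h2 : p.2 = q.2 := by
    ext k
    have := congrFun (congrArg Prod.snd h) k
    rw [monomialExp_snd hn hpm, monomialExp_snd hn hqm] at this
    by_cases h1 : k ∈ p.2 <;> by_cases h2 : k ∈ q.2 <;> simp [h1, h2] at this ⊢
  have h1 := congrArg Prod.fst h
  rw [monomialExp_fst hn hpm, monomialExp_fst hn hqm, h2, Nat.cast_add, Nat.cast_add,
    add_left_inj, ZMod.natCast_eq_natCast_iff'] at h1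
  refine Prod.ext ?_ h2
  rcases mem_basisIndex.1 hp with hp' | rfl <;> rcases mem_basisIndex.1 hq with hq' | rfl
  · rwa [Nat.mod_eq_of_lt hp'.1, Nat.mod_eq_of_lt hq'.1] at h1
  · rw [Nat.mod_eq_of_lt hp'.1, Nat.mod_self] at h1
    exact absurd (Prod.ext (y := (0, ∅)) h1 h2) hp0
  · rw [Nat.mod_eq_of_lt hq'.1, Nat.mod_self] at h1
    exact absurd (Prod.ext (y := (0, ∅)) h1.symm h2.symm) hq0
  · rfl

/-! ### Reduction of monomials in `A_n` and spanning. -/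

section QuotAlg

variable {F : Type*} [Field F] {n : ℕ}

theorem prod_erase_xbar (i : Fin n) : ∏ k ∈ Finset.univ.erase i, xbar F k = xbar F i := by
  have : (∏ k ∈ Finset.univ.erase i, MvPolynomial.X k) - MvPolynomial.X i ∈ binomIdeal F n :=
    Ideal.subset_span ⟨i, rfl⟩
  have h := Ideal.Quotient.eq.2 this
  rwa [map_prod] at h

theorem xbar_mul_self (i : Fin n) : xbar F i * xbar F i = ∏ k, xbar F k := by
  rw [← Finset.mul_prod_erase _ _ (Finset.mem_univ i), prod_erase_xbar]

/-- For `j ≠ i`, the product `p` of the variables other than `i`, `j` swaps `x_i` and `x_j`, so `p *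
p` fixes `x_i`; and `p * p` is a product of `n - 2` squares, each equal to `x_n ^ 2`. -/
theorem xbar_last_pow_mul_xbar (hn : 3 ≤ n) (i : Fin n) :
    xbar F (lastVar hn) ^ (2 * n - 4) * xbar F i = xbar F i := by
  obtain ⟨j, hj⟩ : ∃ j : Fin n, j ≠ i := by
    have : Nontrivial (Fin n) := Fin.nontrivial_iff_two_le.2 (by omega)
    exact exists_ne i
  have hji : j ∈ Finset.univ.erase i := Finset.mem_erase.2 ⟨hj, Finset.mem_univ _⟩
  have hij : i ∈ Finset.univ.erase j := Finset.mem_erase.2 ⟨hj.symm, Finset.mem_univ _⟩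
  set p := ∏ k ∈ (Finset.univ.erase i).erase j, xbar F k with hp
  have h1 : p * xbar F j = xbar F i := by rw [hp, Finset.prod_erase_mul _ _ hji, prod_erase_xbar]
  have h2 : p * xbar F i = xbar F j := by
    rw [hp, Finset.erase_right_comm, Finset.prod_erase_mul _ _ hij, prod_erase_xbar]
  have h3 : xbar F (lastVar hn) ^ (2 * n - 4) = p * p := by
    rw [hp, ← Finset.prod_mul_distrib, Finset.prod_congr rfl fun k _ => xbar_mul_self k,
      Finset.prod_const, Finset.card_erase_of_mem hji, Finset.card_erase_of_mem (Finset.mem_univ _),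
      Finset.card_univ, Fintype.card_fin, ← xbar_mul_self (lastVar hn), ← pow_two, ← pow_mul]
    congr 1
    omega
  rw [h3, mul_assoc, h2, h1]

theorem xbar_last_pow_mul_stdMonomial (hn : 3 ≤ n) {p : ℕ × Finset (Fin n)} (hp : p ≠ (0, ∅)) :
    xbar F (lastVar hn) ^ (2 * n - 4) * stdMonomial F hn p = stdMonomial F hn p := by
  obtain ⟨b, T⟩ := p
  simp only [stdMonomial]
  rcases T.eq_empty_or_nonempty with rfl | ⟨i, hi⟩
  · obtain ⟨c, rfl⟩ : ∃ c, b = c + 1 := Nat.exists_eq_succ_of_ne_zero fun h => hp (by rw [h])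
    rw [pow_succ' _ c, ← mul_assoc, ← mul_assoc, xbar_last_pow_mul_xbar]
  · rw [← Finset.mul_prod_erase _ _ hi, mul_left_comm, ← mul_assoc (xbar F (lastVar hn) ^ (2 * n - 4)),
      xbar_last_pow_mul_xbar]

theorem exists_reducedIndex_stdMonomial (hn : 3 ≤ n) (c : ℕ) (T : Finset (Fin n))
    (hT : T ⊆ midVars n) (h0 : (c, T) ≠ (0, ∅)) :
    ∃ r ∈ reducedIndex n, stdMonomial F hn (c, T) = stdMonomial F hn r := by
  induction c using Nat.strong_induction_on with
  | _ c ih =>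
    by_cases hc : c < 2 * n - 4
    · exact ⟨_, mem_reducedIndex.2 ⟨h0, mem_basisIndex.2 (Or.inl ⟨hc, hT⟩)⟩, rfl⟩
    -- Here lowering the exponent by `2n - 4` would give `1`, where the reduction fails.
    by_cases htop : (c, T) = (2 * n - 4, ∅)
    · exact ⟨_, top_mem_reducedIndex hn, by rw [htop]⟩
    have hne : (c - (2 * n - 4), T) ≠ (0, ∅) := fun h => htop (by
      obtain ⟨h1, h2⟩ := Prod.mk.inj h
      rw [h2, show c = 2 * n - 4 by omega])
    obtain ⟨r, hr, h⟩ := ih (c - (2 * n - 4)) (by omega) hne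
    refine ⟨r, hr, ?_⟩
    rw [← h, ← xbar_last_pow_mul_stdMonomial hn hne]
    simp only [stdMonomial]
    rw [← mul_assoc, ← pow_add, Nat.add_sub_cancel' (not_lt.1 hc)]

theorem exists_reducedIndex_xbar_mul_of_ne (hn : 3 ≤ n) {j : Fin n} (hj : j.val ≠ 0)
    {r : ℕ × Finset (Fin n)} (hr : r ∈ reducedIndex n) :
    ∃ s ∈ reducedIndex n, xbar F j * stdMonomial F hn r = stdMonomial F hn s := by
  obtain ⟨b, T⟩ := r
  obtain ⟨hr0, hr⟩ := mem_reducedIndex.1 hr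
  have hT : T ⊆ midVars n := subset_midVars_of_mem_basisIndex hr
  by_cases hl : j = lastVar hn
  · have h := exists_reducedIndex_stdMonomial (F := F) hn (b + 1) T hT (by simp)
    simpa only [stdMonomial, hl, pow_succ', mul_assoc] using h
  have hjm : j ∈ midVars n := by
    simp only [lastVar, Fin.ext_iff] at hl
    have := j.2
    exact mem_midVars.2 ⟨by omega, by omega⟩
  -- A repeated factor is traded away by `x_j ^ 2 = x_n ^ 2`.
  by_cases hjT : j ∈ T
  · have h := exists_reducedIndex_stdMonomial (F := F) hn (b + 2) (T.erase j)
      ((Finset.erase_subset _ _).trans hT) (by simp)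
    have heq : xbar F j * stdMonomial F hn (b, T) = stdMonomial F hn (b + 2, T.erase j) := by
      simp only [stdMonomial]
      rw [← Finset.mul_prod_erase _ _ hjT, mul_left_comm, ← mul_assoc (xbar F j), xbar_mul_self,
        ← xbar_mul_self (lastVar hn)]
      ring
    rwa [heq]
  · have h := exists_reducedIndex_stdMonomial (F := F) hn b (insert j T)
      (Finset.insert_subset hjm hT) (by simp)
    have heq : xbar F j * stdMonomial F hn (b, T) = stdMonomial F hn (b, insert j T) := by
      simp only [stdMonomial]
      rw [Finset.prod_insert hjT, mul_left_comm]
    rwa [heq]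

/-- Multiplication by a variable maps nonconstant basis monomials to such monomials. -/
theorem exists_reducedIndex_xbar_mul (hn : 3 ≤ n) (j : Fin n)
    {r : ℕ × Finset (Fin n)} (hr : r ∈ reducedIndex n) :
    ∃ s ∈ reducedIndex n, xbar F j * stdMonomial F hn r = stdMonomial F hn s := by
  by_cases hj : j.val = 0
  -- `x_1` is the product of the other variables, which are applied one at a time.
  · rw [← prod_erase_xbar]
    have key : ∀ S : Finset (Fin n), (∀ i ∈ S, i.val ≠ 0) →
        ∃ s ∈ reducedIndex n, (∏ i ∈ S, xbar F i) * stdMonomial F hn r = stdMonomial F hn s := by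
      intro S
      induction S using Finset.induction_on with
      | empty => exact fun _ => ⟨r, hr, by simp⟩
      | insert a S ha ih =>
        intro hS
        obtain ⟨s, hs, h⟩ := ih fun i hi => hS i (Finset.mem_insert_of_mem hi)
        rw [Finset.prod_insert ha, mul_assoc, h]
        exact exists_reducedIndex_xbar_mul_of_ne hn (hS a (Finset.mem_insert_self _ _)) hs
    refine key _ fun i hi h0 => Finset.ne_of_mem_erase hi (Fin.ext (h0.trans hj.symm))
  · exact exists_reducedIndex_xbar_mul_of_ne hn hj hr

theorem exists_reducedIndex_xbar (hn : 3 ≤ n) (j : Fin n) :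
    ∃ s ∈ reducedIndex n, xbar F j = stdMonomial F hn s := by
  have h := exists_reducedIndex_xbar_mul (F := F) hn j (top_mem_reducedIndex hn)
  rwa [show stdMonomial F hn (2 * n - 4, ∅) = xbar F (lastVar hn) ^ (2 * n - 4) by
    simp [stdMonomial], mul_comm, xbar_last_pow_mul_xbar] at h

theorem stdMonomial_zero (hn : 3 ≤ n) : stdMonomial F hn (0, ∅) = 1 := by
  simp [stdMonomial]

/-- The span contains `1` and is stable under multiplication by every variable. -/
theorem span_stdMonomial (hn : 3 ≤ n) :
    Submodule.span F (Set.range fun p : basisIndex n => stdMonomial F hn p.1) = ⊤ := by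
  set V := Submodule.span F (Set.range fun p : basisIndex n => stdMonomial F hn p.1) with hV
  have hmem : ∀ p ∈ basisIndex n, stdMonomial F hn p ∈ V := fun p hp =>
    Submodule.subset_span ⟨⟨p, hp⟩, rfl⟩
  have hone : (1 : QuotAlg F n) ∈ V := stdMonomial_zero (F := F) hn ▸ hmem _ (zero_mem_basisIndex hn)
  have hmul : ∀ (j : Fin n) (a : QuotAlg F n), a ∈ V → xbar F j * a ∈ V := by
    intro j a ha
    induction ha using Submodule.span_induction with
    | mem x hx =>
      obtain ⟨⟨p, hp⟩, rfl⟩ := hx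
      by_cases h0 : p = (0, ∅)
      · obtain ⟨s, hs, h⟩ := exists_reducedIndex_xbar (F := F) hn j
        simp only [h0, stdMonomial_zero, mul_one, h]
        exact hmem s (mem_reducedIndex.1 hs).2
      · obtain ⟨s, hs, h⟩ := exists_reducedIndex_xbar_mul (F := F) hn j
          (mem_reducedIndex.2 ⟨h0, hp⟩)
        simp only [h]
        exact hmem s (mem_reducedIndex.1 hs).2
    | zero => simp
    | add x y _ _ hx hy => rw [mul_add]; exact V.add_mem hx hy
    | smul c x _ hx => rw [mul_smul_comm]; exact V.smul_mem c hx
  refine (Submodule.eq_top_iff').2 fun a => ?_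
  obtain ⟨f, rfl⟩ := Ideal.Quotient.mk_surjective a
  induction f using MvPolynomial.induction_on with
  | C c =>
    have : Ideal.Quotient.mk (binomIdeal F n) (MvPolynomial.C c) = c • (1 : QuotAlg F n) := by
      rw [← mul_one (MvPolynomial.C c), MvPolynomial.C_mul']
      rfl
    rw [this]
    exact V.smul_mem c hone
  | add f g hf hg => rw [map_add]; exact V.add_mem hf hg
  | mul_X f j hf => rw [map_mul, mul_comm]; exact hmul j _ hf

/-! ### Linear independence through the group algebra. -/

/-- The homomorphism from `A_n` to `F × F[G]`, where `G` is the exponent group: the first component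
is evaluation at the origin. -/
noncomputable def toGroupAlg (F : Type*) [Field F] {n : ℕ} (hn : 3 ≤ n) :
    QuotAlg F n →ₐ[F] F × AddMonoidAlgebra F (ExpGroup n) :=
  Ideal.Quotient.liftₐ (binomIdeal F n)
    (MvPolynomial.aeval fun i => ((0 : F), AddMonoidAlgebra.single (varExp i) (1 : F))) (by
      intro a ha
      rw [← RingHom.mem_ker]
      refine (Ideal.span_le.2 ?_ : binomIdeal F n ≤ _) ha
      rintro _ ⟨i, rfl⟩
      rw [SetLike.mem_coe, RingHom.mem_ker, map_sub, map_prod, sub_eq_zero]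
      simp only [MvPolynomial.aeval_X]
      refine Prod.ext ?_ ?_
      · rw [Prod.fst_prod]
        obtain ⟨j, hj⟩ : ∃ j : Fin n, j ≠ i := by
          have : Nontrivial (Fin n) := Fin.nontrivial_iff_two_le.2 (by omega)
          exact exists_ne i
        exact Finset.prod_eq_zero (Finset.mem_erase.2 ⟨hj, Finset.mem_univ _⟩) rfl
      · rw [Prod.snd_prod, AddMonoidAlgebra.prod_single]
        simp [sum_erase_varExp hn])

theorem toGroupAlg_xbar (hn : 3 ≤ n) (i : Fin n) :
    toGroupAlg F hn (xbar F i) = (0, AddMonoidAlgebra.single (varExp i) 1) := by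
  exact MvPolynomial.aeval_X _ i

theorem toGroupAlg_stdMonomial_snd (hn : 3 ≤ n) (p : ℕ × Finset (Fin n)) :
    (toGroupAlg F hn (stdMonomial F hn p)).2 = AddMonoidAlgebra.single (monomialExp hn p) 1 := by
  rw [stdMonomial, map_mul, map_pow, map_prod, Prod.snd_mul, Prod.pow_snd, Prod.snd_prod]
  simp only [toGroupAlg_xbar]
  rw [AddMonoidAlgebra.single_pow, AddMonoidAlgebra.prod_single, AddMonoidAlgebra.single_mul_single]
  simp [monomialExp]

theorem toGroupAlg_stdMonomial_fst (hn : 3 ≤ n) {p : ℕ × Finset (Fin n)} (hp : p ≠ (0, ∅)) :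
    (toGroupAlg F hn (stdMonomial F hn p)).1 = 0 := by
  rw [← xbar_last_pow_mul_stdMonomial hn hp, map_mul, map_pow, toGroupAlg_xbar, Prod.fst_mul,
    Prod.pow_fst, zero_pow (by omega), zero_mul]

/-- The coefficient of `1` must be killed first, by evaluation at the origin, since `1` and `x_n ^
(2n-4)` have the same image in `F[G]`. -/
theorem linearIndependent_stdMonomial (hn : 3 ≤ n) :
    LinearIndependent F fun p : basisIndex n => stdMonomial F hn p.1 := by
  rw [Fintype.linearIndependent_iff]
  intro c hc
  have hΦ := congrArg (toGroupAlg F hn) hc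
  rw [map_sum, map_zero] at hΦ
  simp only [map_smul] at hΦ
  have h0 : c ⟨(0, ∅), zero_mem_basisIndex hn⟩ = 0 := by
    have h1 := congrArg Prod.fst hΦ
    rw [Prod.fst_sum, Finset.sum_eq_single ⟨(0, ∅), zero_mem_basisIndex hn⟩] at h1
    · simpa [stdMonomial_zero] using h1
    · intro p _ hp
      rw [Prod.smul_fst, toGroupAlg_stdMonomial_fst hn (fun h => hp (Subtype.ext h)), smul_zero]
    · simp
  intro p
  by_cases hp : p.1 = (0, ∅)
  · rwa [show p = ⟨(0, ∅), zero_mem_basisIndex hn⟩ from Subtype.ext hp]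
  have h2 := congrArg Prod.snd hΦ
  rw [Prod.snd_sum] at h2
  simp only [Prod.smul_snd, toGroupAlg_stdMonomial_snd, Prod.snd_zero,
    AddMonoidAlgebra.smul_single, smul_eq_mul, mul_one] at h2
  have h3 := congrArg (fun f => AddMonoidAlgebra.coeff f (monomialExp hn p.1)) h2
  simp only [AddMonoidAlgebra.coeff_sum, AddMonoidAlgebra.coeff_single, AddMonoidAlgebra.coeff_zero,
    Finsupp.finsetSum_apply, Finsupp.zero_apply] at h3
  rw [Finset.sum_eq_single p] at h3
  · simpa using h3
  · intro q _ hqp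
    by_cases hq : q.1 = (0, ∅)
    · rw [show q = ⟨(0, ∅), zero_mem_basisIndex hn⟩ from Subtype.ext hq, h0]
      simp
    · refine Finsupp.single_eq_of_ne fun h => hqp (Subtype.ext ?_)
      exact (monomialExp_injOn hn (mem_reducedIndex.2 ⟨hp, p.2⟩) (mem_reducedIndex.2 ⟨hq, q.2⟩)
        h).symm
  · simp

/-- The monomial basis of `A_n`. -/
noncomputable def stdBasis (F : Type*) [Field F] {n : ℕ} (hn : 3 ≤ n) :
    Module.Basis (basisIndex n) F (QuotAlg F n) :=
  Module.Basis.mk (linearIndependent_stdMonomial hn) (span_stdMonomial hn).ge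

theorem stdBasis_apply (hn : 3 ≤ n) (p : basisIndex n) :
    stdBasis F hn p = stdMonomial F hn p.1 := by
  simp [stdBasis]

/-! ### Multiplication by a variable as a translation of exponents. -/

theorem monomialExp_eq_of_xbar_mul (hn : 3 ≤ n) {j : Fin n} {r s : ℕ × Finset (Fin n)}
    (h : xbar F j * stdMonomial F hn r = stdMonomial F hn s) :
    monomialExp hn s = varExp j + monomialExp hn r := by
  have h1 := congrArg (fun a => (toGroupAlg F hn a).2) h
  simp only [map_mul, Prod.snd_mul, toGroupAlg_stdMonomial_snd, toGroupAlg_xbar,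
    AddMonoidAlgebra.single_mul_single, mul_one] at h1
  exact (AddMonoidAlgebra.single_left_injective one_ne_zero h1).symm

/-- Multiplication by a variable permutes the nonconstant basis monomials. -/
theorem exists_perm_xbar_mul (F : Type*) [Field F] (hn : 3 ≤ n) (j : Fin n) :
    ∃ σ : Equiv.Perm (reducedIndex n),
      (∀ r, xbar F j * stdMonomial F hn r.1 = stdMonomial F hn (σ r).1) ∧
      ∀ r (k : ℕ), (σ ^ k) r = r ↔ 2 * (n - 2) ∣ k := by
  choose f hf h using fun r : reducedIndex n =>
    exists_reducedIndex_xbar_mul (F := F) hn j r.2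
  have hexp := fun r => monomialExp_eq_of_xbar_mul hn (h r)
  have hinj : Function.Injective fun r : reducedIndex n => (⟨f r, hf r⟩ : reducedIndex n) := by
    intro r s hrs
    refine Subtype.ext (monomialExp_injOn hn r.2 s.2 (add_left_cancel (a := varExp j) ?_))
    rw [← hexp, ← hexp, show f r = f s from congrArg Subtype.val hrs]
  let σ : Equiv.Perm (reducedIndex n) :=
    Equiv.ofBijective _ (Finite.injective_iff_bijective.1 hinj)
  -- Translations act freely, so whether `σ ^ k` fixes `r` does not depend on `r`.
  have hpow : ∀ r (k : ℕ), monomialExp hn ((σ ^ k) r).1 = k • varExp j + monomialExp hn r.1 := by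
    intro r k
    induction k with
    | zero => simp
    | succ k ih =>
      rw [pow_succ', Equiv.Perm.mul_apply, succ_nsmul', add_assoc, ← ih]
      exact hexp _
  refine ⟨σ, h, fun r k => ?_⟩
  rw [← nsmul_varExp_eq_zero_iff hn j k]
  constructor
  · intro hk
    have := hpow r k
    rw [hk] at this
    exact right_eq_add.1 this
  · intro hk
    refine Subtype.ext (monomialExp_injOn hn (Subtype.prop _) r.2 ?_)
    rw [hpow, hk, zero_add]

theorem reducedCompanion_eq_permMatrix (hn : 3 ≤ n) {B : Module.Basis (basisIndex n) F (QuotAlg F n)}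
    (hB : ∀ p : basisIndex n, B p = stdMonomial F hn p.1) {j : Fin n}
    {σ : Equiv.Perm (reducedIndex n)}
    (hσ : ∀ r, xbar F j * stdMonomial F hn r.1 = stdMonomial F hn (σ r).1) :
    reducedCompanion B j = σ.permMatrix F := by
  ext r l
  have h : xbar F j * B (reducedIncl n r) = B (reducedIncl n (σ r)) := by
    rw [hB, hB]
    exact hσ r
  have hinj : ∀ a b : reducedIndex n, reducedIncl n a = reducedIncl n b ↔ a = b := fun a b =>
    ⟨fun h => Subtype.ext (Subtype.mk.inj h), congrArg _⟩
  rw [reducedCompanion, companionMatrix, Matrix.submatrix_apply, Matrix.of_apply,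
    LinearMap.mulLeft_apply, h, Module.Basis.repr_self, Equiv.Perm.permMatrix,
    PEquiv.toMatrix_toPEquiv_apply, Finsupp.single_apply, Pi.single_apply]
  simp only [hinj, eq_comm]

end QuotAlg

theorem mainTheorem4 (F : Type*) [Field F] (n : ℕ) (hn : 3 ≤ n) :
    Fintype.card (reducedIndex n) = (n - 2) * 2 ^ (n - 1) ∧
    ∃ B : Module.Basis (basisIndex n) F (QuotAlg F n),
      (∀ p : basisIndex n, B p = stdMonomial F hn p.1) ∧
      ∀ j : Fin n,
        (∃ σ : Equiv.Perm (reducedIndex n),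
          reducedCompanion B j = σ.permMatrix F ∧
          σ.support = Finset.univ ∧
          σ.cycleFactorsFinset.card = 2 ^ (n - 2) ∧
          ∀ c ∈ σ.cycleFactorsFinset, c.support.card = 2 * (n - 2)) ∧
        orderOf (reducedCompanion B j) = 2 * (n - 2) ∧
        (reducedCompanion B j).charpoly =
          ((Polynomial.X : Polynomial F) ^ (2 * (n - 2)) - 1) ^ (2 ^ (n - 2)) := by
  have hcard : Fintype.card (reducedIndex n) = (n - 2) * 2 ^ (n - 1) := by
    rw [Fintype.card_coe, card_reducedIndex hn]
  have hm : 2 ^ (n - 2) * (2 * (n - 2)) = Fintype.card (reducedIndex n) := by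
    rw [hcard, show n - 1 = n - 2 + 1 by omega, pow_succ]
    ring
  refine ⟨hcard, stdBasis F hn, stdBasis_apply hn, fun j => ?_⟩
  obtain ⟨σ, hmul, hσ⟩ := exists_perm_xbar_mul F hn j
  have hP := reducedCompanion_eq_permMatrix hn (stdBasis_apply hn) hmul
  have hd : 2 ≤ 2 * (n - 2) := by omega
  have : Nonempty (reducedIndex n) := ⟨⟨_, top_mem_reducedIndex hn⟩⟩
  refine ⟨⟨σ, hP, Equiv.Perm.support_eq_univ_of_pow_apply_eq_iff hd hσ, ?_,
    fun c hc => Equiv.Perm.card_support_of_mem_cycleFactorsFinset hσ hc⟩, ?_, ?_⟩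
  · refine Nat.eq_of_mul_eq_mul_right (by omega : 0 < 2 * (n - 2)) ?_
    rw [hm, Equiv.Perm.card_cycleFactorsFinset_mul hd hσ]
  · rw [hP, Equiv.Perm.orderOf_permMatrix, Equiv.Perm.orderOf_eq_of_pow_apply_eq_iff hσ]
  · rw [hP, Equiv.Perm.charpoly_permMatrix_of_pow_apply_eq_iff F (by omega) hm hσ]
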